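/- Let $G$ be a finite simple graph with degree matrix $\Delta$ and adjacency matrix $A$, let $L_+=\Delta+A$ be its unsigned Laplacian, and let $U(t)=\exp(itL_+)$ for $t\in\mathbb{R}$. For distinct vertices $a,b$ of $G$, the plus state of the pair $\{a,b\}$ is the vector $e_a+e_b$, where $e_v$ is the characteristic vector of the vertex $v$. We say that $G$ has perfect plus state transfer if there are two different unordered pairs $\{a,b\}\neq\{c,d\}$ of distinct vertices of $G$, at least one of which is an edge of $G$, a time $t\ge 0$ and a complex number $\gamma$ with $|\gamma|=1$ such that \[ U(t)(e_a+e_b)=\gamma\,(e_c+e_d). \] Theorem. Let $n\ge 3$ and let $C_n$ be the cycle on $n$ vertices. Then $C_n$ has perfect plus state transfer if and only if $n=4$. -/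

import Mathlib

open scoped Matrix

noncomputable section

namespace SimpleGraph

variable {V : Type*} [Fintype V] [DecidableEq V]

/-- The unsigned Laplacian `L₊(G) = Δ(G) + A(G)`, as a complex matrix. -/
def unsignedLaplacian (G : SimpleGraph V) [DecidableRel G.Adj] : Matrix V V ℂ :=
  G.degMatrix ℂ + G.adjMatrix ℂ

/-- The transition matrix `U(t) = exp(i t L₊)` of the continuous quantum walk on `G` whose
Hamiltonian is the unsigned Laplacian. -/
def unsignedTransition (G : SimpleGraph V) [DecidableRel G.Adj] (t : ℝ) : Matrix V V ℂ :=
  NormedSpace.exp ((Complex.I * (t : ℂ)) • G.unsignedLaplacian)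

/-- The plus state `e_a + e_b` (not normalized). -/
def plusState (a b : V) : V → ℂ :=
  Pi.single a 1 + Pi.single b 1

/-- `U(t)(e_a + e_b) = γ (e_c + e_d)` for some time `t ≥ 0` and some complex `γ` of norm one.
For `{c, d} = {a, b}` this is periodicity of the plus state. -/
def PlusStateTransfer (G : SimpleGraph V) [DecidableRel G.Adj] (a b c d : V) : Prop :=
  ∃ t : ℝ, 0 ≤ t ∧ ∃ γ : ℂ, ‖γ‖ = 1 ∧
    G.unsignedTransition t *ᵥ plusState a b = γ • plusState c d

/-- `G` has perfect plus state transfer: there is perfect state transfer between the plus states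
of two different unordered pairs of distinct vertices, at least one of which is an edge. -/
def HasPerfectPlusStateTransfer (G : SimpleGraph V) [DecidableRel G.Adj] : Prop :=
  ∃ a b c d : V, a ≠ b ∧ c ≠ d ∧ s(a, b) ≠ s(c, d) ∧ (G.Adj a b ∨ G.Adj c d) ∧
    G.PlusStateTransfer a b c d

end SimpleGraph

end

/-! The characters `v ↦ ζ ^ v` of the cyclic group are eigenvectors with eigenvalue `2 + ζ + ζ⁻¹`,
and a transfer is tested against them. For `ω = exp (2πi/n)`, comparing norms shows that the target
pair is an edge too. Since `ω` and `ω⁻¹` share an eigenvalue, the two edges are antipodal: `ω ^ c =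
-ω ^ a`. If `n ≠ 4`, the frequencies 0, 1, 2 then have phases `γ`, `-γ`, `γ`, which Niven's theorem
and parity exclude (`false_of_phases`). -/

open scoped Matrix

namespace Matrix

/-- An eigenvector of `M` for `μ` is an eigenvector of `exp M` for `exp μ`. -/
theorem exp_mulVec_of_mulVec_eq_smul {m : Type*} [Fintype m] [DecidableEq m]
    {M : Matrix m m ℂ} {μ : ℂ} {v : m → ℂ} (h : M *ᵥ v = μ • v) :
    NormedSpace.exp M *ᵥ v = Complex.exp μ • v := by
  -- The exponential depends only on the topology, so any compatible algebra norm gives its series.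
  let _ : NormedRing (Matrix m m ℂ) := Matrix.linftyOpNormedRing
  let _ : NormedAlgebra ℂ (Matrix m m ℂ) := Matrix.linftyOpNormedAlgebra
  have hpow (k : ℕ) : (M ^ k) *ᵥ v = μ ^ k • v := by
    induction k with
    | zero => simp
    | succ k ih => rw [pow_succ, ← mulVec_mulVec, h, mulVec_smul, ih, smul_smul, pow_succ']
  have h₁ := (NormedSpace.exp_series_hasSum_exp' (𝕂 := ℂ) M).map
    (AddMonoidHom.mk' (fun A : Matrix m m ℂ => A *ᵥ v) fun A B => add_mulVec A B v)
    (continuous_id.matrix_mulVec continuous_const)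
  have h₂ := (NormedSpace.exp_series_hasSum_exp' (𝕂 := ℂ) μ).smul_const v
  rw [← Complex.exp_eq_exp_ℂ] at h₂
  refine h₁.unique ?_
  convert h₂ using 2 with k
  simp [smul_mulVec, hpow, smul_smul]

end Matrix

namespace SimpleGraph

section General

variable {V : Type*} [Fintype V] [DecidableEq V] (G : SimpleGraph V) [DecidableRel G.Adj]

theorem isSymm_unsignedLaplacian : G.unsignedLaplacian.IsSymm := by
  simp [unsignedLaplacian, Matrix.IsSymm, degMatrix, transpose_adjMatrix]

theorem unsignedLaplacian_mulVec_apply (v : V) (x : V → ℂ) :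
    (G.unsignedLaplacian *ᵥ x) v = G.degree v * x v + ∑ u ∈ G.neighborFinset v, x u := by
  rw [unsignedLaplacian, Matrix.add_mulVec, Pi.add_apply, degMatrix_mulVec_apply,
    adjMatrix_mulVec_apply]

theorem unsignedTransition_mulVec_of_eigenvector {μ : ℂ} {x : V → ℂ}
    (h : G.unsignedLaplacian *ᵥ x = μ • x) (t : ℝ) :
    G.unsignedTransition t *ᵥ x = Complex.exp (Complex.I * t * μ) • x :=
  Matrix.exp_mulVec_of_mulVec_eq_smul (by rw [Matrix.smul_mulVec, h, smul_smul])

theorem dotProduct_plusState (x : V → ℂ) (a b : V) : x ⬝ᵥ plusState a b = x a + x b := by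
  simp [plusState, dotProduct_add]

/-- A plus state transfer, tested against an eigenvector of the unsigned Laplacian. -/
theorem exp_mul_add_eq_of_transfer {μ γ : ℂ} {x : V → ℂ} {t : ℝ} {a b c d : V}
    (h : G.unsignedLaplacian *ᵥ x = μ • x)
    (hU : G.unsignedTransition t *ᵥ plusState a b = γ • plusState c d) :
    Complex.exp (Complex.I * t * μ) * (x a + x b) = γ * (x c + x d) := by
  have hsymm : (G.unsignedTransition t)ᵀ = G.unsignedTransition t :=
    Matrix.IsSymm.exp (G.isSymm_unsignedLaplacian.smul _)
  have := congrArg (x ⬝ᵥ ·) hU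
  simpa only [Matrix.dotProduct_mulVec, ← Matrix.mulVec_transpose, hsymm,
    G.unsignedTransition_mulVec_of_eigenvector h, smul_dotProduct, dotProduct_smul,
    dotProduct_plusState, smul_eq_mul] using this

end General

/-! ### Characters of the cycle -/

section Cycle

theorem pow_val_add {n : ℕ} {ζ : ℂ} (hζ : ζ ^ n = 1) (u v : Fin n) :
    ζ ^ (u + v).val = ζ ^ u.val * ζ ^ v.val := by
  rw [Fin.val_add, ← pow_add, ← pow_eq_pow_mod _ hζ]

theorem pow_val_add_one {n : ℕ} {ζ : ℂ} (hζ : ζ ^ (n + 3) = 1) (v : Fin (n + 3)) :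
    ζ ^ (v + 1).val = ζ ^ v.val * ζ := by
  rw [pow_val_add hζ, show (1 : Fin (n + 3)).val = 1 from rfl, pow_one]

theorem cycleGraph_unsignedLaplacian_mulVec {n : ℕ} {ζ : ℂ} (hζ : ζ ^ (n + 3) = 1) :
    (cycleGraph (n + 3)).unsignedLaplacian *ᵥ (fun v => ζ ^ v.val) =
      (2 + ζ + ζ⁻¹) • (fun v : Fin (n + 3) => ζ ^ v.val) := by
  ext v
  have h0 : ζ ≠ 0 := by rintro rfl; simp at hζ
  have hsub : ζ ^ (v - 1).val = ζ ^ v.val * ζ⁻¹ := by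
    rw [eq_mul_inv_iff_mul_eq₀ h0, ← pow_val_add_one hζ, sub_add_cancel]
  -- Length at least 3 keeps the two neighbours distinct.
  have hne : v - 1 ≠ v + 1 := by
    simp only [ne_eq, sub_eq_iff_eq_add, add_assoc v, left_eq_add]
    exact ne_of_beq_false rfl
  rw [unsignedLaplacian_mulVec_apply, cycleGraph_degree_three_le, cycleGraph_neighborFinset,
    Finset.sum_pair hne, hsub, pow_val_add_one hζ, Pi.smul_apply, smul_eq_mul]
  push_cast
  ring

/-- Two unit complex numbers at the same distance from `-1` are equal or inverse. -/
theorem eq_or_eq_inv_of_norm_one_add_eq {z w : ℂ} (hz : ‖z‖ = 1) (hw : ‖w‖ = 1)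
    (h : ‖1 + z‖ = ‖1 + w‖) : z = w ∨ z = w⁻¹ := by
  have key {u : ℂ} (hu : ‖u‖ = 1) : ‖1 + u‖ ^ 2 = 2 + 2 * u.re ∧ u.re ^ 2 + u.im ^ 2 = 1 := by
    have h₁ : u.re ^ 2 + u.im ^ 2 = 1 := by
      have := Complex.sq_norm u
      rw [hu, Complex.normSq_apply] at this
      linarith
    refine ⟨?_, h₁⟩
    rw [Complex.sq_norm, Complex.normSq_apply]
    simp
    linarith
  obtain ⟨hz₁, hz₂⟩ := key hz
  obtain ⟨hw₁, hw₂⟩ := key hw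
  rw [h] at hz₁
  have hre : z.re = w.re := by linarith
  have him : z.im ^ 2 = w.im ^ 2 := by rw [hre] at hz₂; linarith
  rcases sq_eq_sq_iff_eq_or_eq_neg.mp him with him | him
  · exact Or.inl (Complex.ext hre him)
  · right
    rw [Complex.inv_eq_conj hw]
    exact Complex.ext hre him

/-- If the phases of the cycle at the frequencies `0`, `1`, `2` are `γ`, `-γ`, `γ`, then
`2 cos (2π / n)` is rational with odd denominator and even numerator, against Niven's theorem. -/
theorem false_of_phases {n : ℕ} {t x : ℝ} {γ : ℂ}
    (hx : x = 2 * Real.cos (2 * Real.pi / n)) (hx₀ : x ≠ 0) (hx₂ : x ≠ -2)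
    (h₀ : Complex.exp (Complex.I * t * 4) = γ)
    (h₁ : Complex.exp (Complex.I * t * (2 + x)) = -γ)
    (h₂ : Complex.exp (Complex.I * t * x ^ 2) = γ) : False := by
  have hpi := Real.pi_ne_zero
  obtain ⟨q, hq⟩ := Complex.exp_eq_exp_iff_exists_int.mp (h₂.trans h₀.symm)
  have h₁' : Complex.exp (Complex.I * t * (2 + x)) =
      Complex.exp (Complex.I * t * 4 + Real.pi * Complex.I) := by
    rw [h₁, Complex.exp_add, h₀, Complex.exp_pi_mul_I]; ring
  obtain ⟨p, hp⟩ := Complex.exp_eq_exp_iff_exists_int.mp h₁'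
  have hq' : t * (x ^ 2 - 4) = 2 * q * Real.pi := by
    apply Complex.ofReal_injective
    apply mul_left_cancel₀ Complex.I_ne_zero
    push_cast
    linear_combination hq
  have hp' : t * (x - 2) = (2 * p + 1) * Real.pi := by
    apply Complex.ofReal_injective
    apply mul_left_cancel₀ Complex.I_ne_zero
    push_cast
    linear_combination hp
  have hodd : (2 * (p : ℝ) + 1) ≠ 0 := by
    have : (2 * p + 1 : ℤ) ≠ 0 := by omega
    exact_mod_cast this
  -- Factoring `x ^ 2 - 4 = (x + 2) * (x - 2)` eliminates `t`.
  have hmul : (x + 2) * (2 * p + 1) = 2 * q := by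
    apply mul_right_cancel₀ hpi
    linear_combination hq' - (x + 2) * hp'
  have hrat : ∃ r : ℚ, Real.cos (2 * Real.pi / n) = r := by
    refine ⟨(2 * q / (2 * p + 1) - 2) / 2, ?_⟩
    push_cast
    rw [← hmul, mul_div_cancel_right₀ _ hodd, hx]
    ring
  have hniven := niven ⟨2 / n, by push_cast; ring⟩ hrat
  have hcases : x = -2 ∨ x = -1 ∨ x = 0 ∨ x = 1 ∨ x = 2 := by
    simp only [Set.mem_insert_iff, Set.mem_singleton_iff] at hniven
    rcases hniven with h | h | h | h | h <;> rw [h] at hx <;> norm_num at hx <;> simp [hx]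
  rcases hcases with rfl | rfl | rfl | rfl | rfl
  · exact hx₂ rfl
  · have : (-1 + 2 : ℤ) * (2 * p + 1) = 2 * q := by exact_mod_cast hmul
    omega
  · exact hx₀ rfl
  · have : (1 + 2 : ℤ) * (2 * p + 1) = 2 * q := by exact_mod_cast hmul
    omega
  · rw [sub_self, mul_zero] at hp'
    exact mul_ne_zero hodd hpi hp'.symm

/-- The character sums of a plus state transfer from an edge of a cycle force length four. -/
theorem eq_four_of_character_sums {n : ℕ} {t : ℝ} {γ : ℂ} (hγ : ‖γ‖ = 1)
    {a b c d : Fin (n + 3)} (hne : s(a, b) ≠ s(c, d)) (hab : (cycleGraph (n + 3)).Adj a b)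
    (h : ∀ ζ : ℂ, ζ ^ (n + 3) = 1 →
      Complex.exp (Complex.I * t * (2 + ζ + ζ⁻¹)) * (ζ ^ a.val + ζ ^ b.val) =
        γ * (ζ ^ c.val + ζ ^ d.val)) : n + 3 = 4 := by
  wlog hb : b = a + 1 generalizing a b
  · refine this (a := b) (b := a) (by rwa [Sym2.eq_swap]) hab.symm
      (fun ζ hζ => by rw [add_comm (ζ ^ b.val)]; exact h ζ hζ) ?_
    rw [cycleGraph_adj] at hab
    rcases hab with hab | hab
    · rw [← hab]; abel
    · exact absurd (by rw [← hab]; abel) hb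
  subst hb
  set ω : ℂ := Complex.exp (2 * Real.pi * Complex.I / (n + 3 : ℕ)) with hω_def
  have hω : IsPrimitiveRoot ω (n + 3) := Complex.isPrimitiveRoot_exp _ (by omega)
  have hω1 : ω ^ (n + 3) = 1 := hω.pow_eq_one
  have hω0 : ω ≠ 0 := hω.ne_zero (by omega)
  have hnorm : ‖ω‖ = 1 := hω.norm'_eq_one (by omega)
  have hinj {u v : Fin (n + 3)} (huv : ω ^ u.val = ω ^ v.val) : u = v :=
    Fin.ext (hω.pow_inj u.isLt v.isLt huv)
  set x : ℝ := 2 * Real.cos (2 * Real.pi / (n + 3 : ℕ)) with hx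
  have hωx : ω + ω⁻¹ = x := by
    rw [hω_def, ← Complex.exp_neg, hx]
    push_cast
    rw [Complex.cos]
    ring_nf
  have hexp : ‖Complex.exp (Complex.I * t * (2 + ω + ω⁻¹))‖ = 1 := by
    rw [add_assoc, hωx, mul_assoc, mul_comm]
    exact_mod_cast Complex.norm_exp_ofReal_mul_I (t * (2 + x))
  -- At `ω` the norms give `‖1 + ω‖ = ‖1 + ω ^ (d - c)‖`.
  have hcd : d = c + 1 ∨ c = d + 1 := by
    have h1 := congrArg norm (h ω hω1)
    rw [norm_mul, norm_mul, hexp, hγ, one_mul, one_mul, pow_val_add_one hω1] at h1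
    have e₁ : ω ^ a.val + ω ^ a.val * ω = ω ^ a.val * (1 + ω) := by ring
    have e₂ : ω ^ c.val + ω ^ d.val = ω ^ c.val * (1 + ω ^ d.val / ω ^ c.val) := by
      field_simp
    rw [e₁, e₂, norm_mul, norm_mul, norm_pow, norm_pow, hnorm, one_pow, one_pow, one_mul,
      one_mul] at h1
    rcases eq_or_eq_inv_of_norm_one_add_eq (by simp [hnorm]) hnorm h1.symm with h2 | h2
    · left
      apply hinj
      rw [pow_val_add_one hω1]
      field_simp at h2
      rw [h2]
    · right
      apply hinj
      rw [pow_val_add_one hω1]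
      field_simp at h2
      rw [← h2]
  wlog hd : d = c + 1 generalizing c d
  · exact this (c := d) (d := c) (by rwa [Sym2.eq_swap (a := d)])
      (fun ζ hζ => by rw [add_comm (ζ ^ d.val)]; exact h ζ hζ) hcd.symm (hcd.resolve_left hd)
  subst hd
  have hac : a ≠ c := by rintro rfl; exact hne rfl
  have hphase (ζ : ℂ) (hζ : ζ ^ (n + 3) = 1) (hζ1 : 1 + ζ ≠ 0) :
      Complex.exp (Complex.I * t * (2 + ζ + ζ⁻¹)) * ζ ^ a.val = γ * ζ ^ c.val := by
    apply mul_right_cancel₀ hζ1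
    have := h ζ hζ
    rw [pow_val_add_one hζ, pow_val_add_one hζ] at this
    linear_combination this
  have hsq : ω ^ 2 ≠ 1 := hω.pow_ne_one_of_pos_of_lt (by omega) (by omega)
  have hω1' : 1 + ω ≠ 0 := fun h' => hsq (by linear_combination (ω - 1) * h')
  have hinv1 : 1 + ω⁻¹ ≠ 0 := fun h' => hω1' (by
    have := congrArg (ω * ·) h'
    field_simp at this
    linear_combination this)
  have hγ0 : γ ≠ 0 := by rintro rfl; simp at hγ
  have p₀ := hphase 1 (one_pow _) (by norm_num)
  have p₁ := hphase ω hω1 hω1'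
  have p₂ := hphase ω⁻¹ (by rw [inv_pow, hω1, inv_one]) hinv1
  have hneg : ω ^ c.val = -ω ^ a.val := by
    rw [inv_inv, add_right_comm, inv_pow, inv_pow] at p₂
    have : (ω ^ c.val) ^ 2 = (ω ^ a.val) ^ 2 := by
      apply mul_left_cancel₀ hγ0
      generalize Complex.exp (Complex.I * t * (2 + ω + ω⁻¹)) = E at p₁ p₂
      field_simp at p₂
      linear_combination ω ^ a.val * p₂ - ω ^ c.val * p₁
    rcases sq_eq_sq_iff_eq_or_eq_neg.mp this with h' | h'
    · exact absurd (hinj h').symm hac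
    · exact h'
  by_contra hn4
  -- Only here is `n + 3 ≠ 4` needed: the edge factor at frequency 2 vanishes exactly when `ω` has
  -- order 4.
  have hω2 : 1 + ω ^ 2 ≠ 0 := by
    intro h'
    have h4 : ω ^ 4 = 1 := by linear_combination (ω ^ 2 - 1) * h'
    have := Nat.le_of_dvd (by norm_num) (hω.dvd_of_pow_eq_one 4 h4)
    have hn0 : n = 0 := by omega
    subst hn0
    exact absurd (hω.dvd_of_pow_eq_one 4 h4) (by norm_num)
  have p₃ := hphase (ω ^ 2) (by rw [← pow_mul, mul_comm, pow_mul, hω1, one_pow]) hω2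
  have hω2x : (2 : ℂ) + ω ^ 2 + (ω ^ 2)⁻¹ = (x : ℂ) ^ 2 := by
    rw [← hωx]
    field_simp
    ring
  refine false_of_phases (n := n + 3) (t := t) (γ := γ) hx ?_ ?_ ?_ ?_ ?_
  · intro h0
    rw [h0, Complex.ofReal_zero] at hωx
    apply hω2
    field_simp at hωx
    linear_combination hωx
  · intro h0
    rw [h0] at hωx
    push_cast at hωx
    field_simp at hωx
    have : (1 + ω) ^ 2 = 0 := by linear_combination hωx
    exact hω1' (pow_eq_zero_iff (by norm_num) |>.mp this)
  · rw [show (2 + 1 + 1⁻¹ : ℂ) = 4 by norm_num] at p₀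
    simpa using p₀
  · rw [add_assoc, hωx, hneg] at p₁
    apply mul_right_cancel₀ (pow_ne_zero a.val hω0)
    linear_combination p₁
  · rw [hω2x, ← pow_mul, ← pow_mul, mul_comm 2, mul_comm 2, pow_mul, pow_mul, hneg, neg_sq] at p₃
    exact mul_right_cancel₀ (pow_ne_zero 2 (pow_ne_zero a.val hω0)) p₃

theorem cycleGraph_four_hasPerfectPlusStateTransfer :
    (cycleGraph 4).HasPerfectPlusStateTransfer := by
  -- At time `π / 2` the eigenvalues 4 and 2 acquire phases 1 and -1; flipping the sign of the
  -- second component of `e₀ + e₁` gives `e₂ + e₃`.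
  refine ⟨0, 1, 2, 3, by decide, by decide, by decide, Or.inl (by decide),
    Real.pi / 2, by positivity, 1, by simp, ?_⟩
  have hnb (v : Fin 4) : (cycleGraph 4).neighborFinset v = {v - 1, v + 1} :=
    cycleGraph_neighborFinset
  have hL (x : Fin 4 → ℂ) : (cycleGraph 4).unsignedLaplacian *ᵥ x =
      fun v => 2 * x v + (x (v - 1) + x (v + 1)) := by
    ext v
    rw [unsignedLaplacian_mulVec_apply, cycleGraph_degree_three_le (n := 1), hnb,
      Finset.sum_pair (by revert v; decide)]
    norm_num
  have h₁ : (cycleGraph 4).unsignedLaplacian *ᵥ ![1, 1, 1, 1] = (4 : ℂ) • ![1, 1, 1, 1] := by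
    rw [hL]; ext v; fin_cases v <;> simp <;> norm_num
  have h₂ : (cycleGraph 4).unsignedLaplacian *ᵥ ![1, 1, -1, -1] = (2 : ℂ) • ![1, 1, -1, -1] := by
    rw [hL]; ext v; fin_cases v <;> simp
  have e₁ := unsignedTransition_mulVec_of_eigenvector _ h₁ (Real.pi / 2)
  have e₂ := unsignedTransition_mulVec_of_eigenvector _ h₂ (Real.pi / 2)
  have hs : (plusState 0 1 : Fin 4 → ℂ) =
      (1 / 2 : ℂ) • (![1, 1, 1, 1] + ![1, 1, -1, -1]) := by
    ext v; fin_cases v <;> simp [plusState] <;> norm_num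
  have hs' : (plusState 2 3 : Fin 4 → ℂ) =
      (1 / 2 : ℂ) • (![1, 1, 1, 1] - ![1, 1, -1, -1]) := by
    ext v; fin_cases v <;> simp [plusState] <;> norm_num
  have x₁ : Complex.exp (Complex.I * (Real.pi / 2 : ℝ) * 4) = 1 := by
    rw [← Complex.exp_two_pi_mul_I]; push_cast; ring_nf
  have x₂ : Complex.exp (Complex.I * (Real.pi / 2 : ℝ) * 2) = -1 := by
    rw [← Complex.exp_pi_mul_I]; push_cast; ring_nf
  rw [hs, hs', Matrix.mulVec_smul, Matrix.mulVec_add, e₁, e₂, x₁, x₂, one_smul, one_smul,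
    neg_one_smul, sub_eq_add_neg]

end Cycle

end SimpleGraph

theorem mainTheorem8 (n : ℕ) (hn : 3 ≤ n) :
    (SimpleGraph.cycleGraph n).HasPerfectPlusStateTransfer ↔ n = 4 := by
  constructor
  · obtain ⟨n, rfl⟩ := Nat.exists_eq_add_of_le' hn
    rintro ⟨a, b, c, d, -, -, hne, hadj, t, -, γ, hγ, hU⟩
    have hsum (ζ : ℂ) (hζ : ζ ^ (n + 3) = 1) :=
      SimpleGraph.exp_mul_add_eq_of_transfer _
        (SimpleGraph.cycleGraph_unsignedLaplacian_mulVec hζ) hU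
    rcases hadj with hab | hcd
    · exact SimpleGraph.eq_four_of_character_sums hγ hne hab hsum
    -- The transfer is run backwards; the sign of the time plays no role in the lemma.
    · refine SimpleGraph.eq_four_of_character_sums (t := -t) (γ := γ⁻¹) (by simp [hγ])
        hne.symm hcd fun ζ hζ => ?_
      have hγ0 : γ ≠ 0 := by rintro rfl; simp at hγ
      rw [Complex.ofReal_neg, mul_neg, neg_mul, Complex.exp_neg, inv_mul_eq_iff_eq_mul₀
        (Complex.exp_ne_zero _), mul_left_comm, hsum ζ hζ, inv_mul_cancel_left₀ hγ0]
  · rintro rfl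
    exact SimpleGraph.cycleGraph_four_hasPerfectPlusStateTransfer
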